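/- Let $k$ be a field, let $n,e,r\ge 0$ be integers, and let $S=k[x_0,\dots,x_{n+e}]$ with its standard grading. For a homogeneous ideal $I\subseteq S$ and $d\ge 0$ let $I_{\langle d\rangle}$ denote the ideal generated by all homogeneous polynomials of degree $d$ in $I$. The ideal $I$ is called componentwise linear if for every $d$ the ideal $I_{\langle d\rangle}$ has a linear minimal free resolution, that is, there is an integer $c$ such that the $i$-th module of the minimal graded free resolution of $I_{\langle d\rangle}$ over $S$ is of the form $S(-c-i)^{\beta_i}$ for all $i\ge 0$. Let $u$ be a monomial of degree $r$ in $x_0,\dots,x_{e-1}$, and let $v$ be a monomial of positive degree in $x_e,\dots,x_{n+e}$. Then the ideal $$I=(x_0,\dots,x_{e-1})^{r+1}+(uv)\subseteq S$$ is componentwise linear. -/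

import Mathlib

open MvPolynomial

/-- A minimal graded free resolution
`⋯ → F₂ → F₁ → F₀ → I → 0` of an ideal `I` of the standard graded polynomial ring
`S = k[x_s : s ∈ σ]`, written in coordinates: `Fᵢ = ⨁_{j : ι i} S(-shift i j)` has the finite
homogeneous basis `ι i`, the augmentation `F₀ → I` sends the basis to the family `gen`, and the
differential `F_{i+1} → Fᵢ` is multiplication by the matrix `diff i`. -/
structure MinimalGradedFreeResolution {σ k : Type*} [Field k]
    (I : Ideal (MvPolynomial σ k)) where
  /-- index set of the homogeneous basis of `Fᵢ` -/
  ι : ℕ → Type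
  [fintype : ∀ i, Fintype (ι i)]
  /-- degrees of the basis elements of `Fᵢ` -/
  shift : ∀ i, ι i → ℕ
  /-- images in `I` of the basis elements of `F₀` -/
  gen : ι 0 → MvPolynomial σ k
  /-- matrix of the differential `F_{i+1} → Fᵢ` -/
  diff : ∀ i, Matrix (ι i) (ι (i + 1)) (MvPolynomial σ k)
  /-- the augmentation preserves degrees -/
  gen_homogeneous : ∀ j, (gen j).IsHomogeneous (shift 0 j)
  /-- the differentials preserve degrees (an entry whose degree would be negative is zero) -/
  diff_homogeneous : ∀ i p q, diff i p q = 0 ∨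
    ∃ m : ℕ, shift i p + m = shift (i + 1) q ∧ (diff i p q).IsHomogeneous m
  /-- the augmentation maps `F₀` onto `I` -/
  range_gen : LinearMap.range (Fintype.linearCombination (MvPolynomial σ k) gen) = I
  /-- exactness at `F₀` -/
  exact_zero : Function.Exact (diff 0).mulVecLin
    (Fintype.linearCombination (MvPolynomial σ k) gen)
  /-- exactness at `F_{i+1}` -/
  exact_succ : ∀ i, Function.Exact (diff (i + 1)).mulVecLin (diff i).mulVecLin
  /-- minimality: the entries of the differentials lie in the ideal generated by the variables -/
  minimal : ∀ i p q, constantCoeff (diff i p q) = 0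

/-- `I` has a linear minimal free resolution: for some `c`, every basis element of the `i`-th
free module has degree `c + i`, i.e. `Fᵢ = S(-c-i)^{βᵢ}` for all `i`. -/
def HasLinearResolution {σ k : Type*} [Field k] (I : Ideal (MvPolynomial σ k)) : Prop :=
  ∃ (F : MinimalGradedFreeResolution I) (c : ℕ), ∀ i j, F.shift i j = c + i

/-- The ideal `I_⟨d⟩` generated by all homogeneous polynomials of degree `d` in `I`. -/
noncomputable def componentIdeal {σ k : Type*} [Field k] (I : Ideal (MvPolynomial σ k)) (d : ℕ) :
    Ideal (MvPolynomial σ k) :=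
  Ideal.span {f | f ∈ I ∧ f.IsHomogeneous d}

attribute [local instance] MvPolynomial.gradedAlgebra

/-- A homogeneous ideal `I` is componentwise linear if `I_⟨d⟩` has a linear minimal free
resolution for all `d`. -/
def IsComponentwiseLinear {σ k : Type*} [Field k] (I : Ideal (MvPolynomial σ k)) : Prop :=
  I.IsHomogeneous (homogeneousSubmodule σ k) ∧ ∀ d : ℕ, HasLinearResolution (componentIdeal I d)

-- The ideal is spanned by the monomials with exponents in an upward closed set `E`, so its degree
-- `d` component is generated by the monomials of `E` of degree `d`. Taken in decreasing
-- lexicographic order, with `x_0 > x_1 > ⋯`, these have linear quotients: if `J` is spanned by the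
-- earlier monomials and `p` is the next one, then `L = J : p` is generated by variables. This
-- follows from `exists_exchange`: if `y` precedes `x` and they first differ at `j`, then some `x ·
-- x_j / x_l` with `l > j` stays in the ideal.
--
-- Linear quotients give a linear resolution through `0 → J → J + (p) → (S/L)(-d) → 0`: the right
-- term is resolved linearly by iterated mapping cones, as in the Koszul complex, and the horseshoe
-- lemma then treats the middle term (`LinearlyResolved.extension`, `LinearlyResolved.cokernel`).
--
-- No complexes are handled along the way. `LinearlyResolved` is coinductive: generators in degree
-- `0`, and a syzygy module that, shifted by one, is again `LinearlyResolved`. Only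
-- `LinearlyResolved.hasLinearResolution` unrolls it into matrices.

universe u

/-! ### Linear resolutions as a coinductive property of modules. -/

/-- The grading on a submodule of a free module whose basis elements have degree `-1`. -/
noncomputable def syzygyGrading {σ ι : Type} {k : Type u} [Field k]
    (N : Submodule (MvPolynomial σ k) (ι → MvPolynomial σ k)) (j : ℕ) : AddSubgroup N where
  carrier := {z | ∀ i, (z.1 i).IsHomogeneous (j + 1)}
  add_mem' ha hb i := (ha i).add (hb i)
  zero_mem' _ := isHomogeneous_zero _ _ _
  neg_mem' ha i := (ha i).neg

/-- `M`, with homogeneous pieces `G`, has a finite family of generators in degree `0` which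
generates every piece, and whose module of syzygies, generated in degree `1`, satisfies `Q`. -/
def LinearCover {σ : Type} {k : Type u} [Field k]
    (Q : ∀ (M : Type u) [AddCommGroup M] [Module (MvPolynomial σ k) M],
      (ℕ → AddSubgroup M) → Prop)
    (M : Type u) [AddCommGroup M] [Module (MvPolynomial σ k) M] (G : ℕ → AddSubgroup M) : Prop :=
  ∃ (ι : Type) (_ : Fintype ι) (g : ι → M),
    Function.Surjective (Fintype.linearCombination (MvPolynomial σ k) g) ∧
    (∀ j m, m ∈ G j ↔ ∃ z : ι → MvPolynomial σ k, (∀ i, (z i).IsHomogeneous j) ∧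
      Fintype.linearCombination (MvPolynomial σ k) g z = m) ∧
    Q (LinearMap.ker (Fintype.linearCombination (MvPolynomial σ k) g)) (syzygyGrading _)

/-- `M`, with homogeneous pieces `G`, is generated in degree `0` and all its syzygies are linear:
the largest predicate `Q` that implies `LinearCover Q`. -/
def LinearlyResolved {σ : Type} {k : Type u} [Field k]
    (M : Type u) [AddCommGroup M] [Module (MvPolynomial σ k) M] (G : ℕ → AddSubgroup M) : Prop :=
  ∃ Q : ∀ (M : Type u) [AddCommGroup M] [Module (MvPolynomial σ k) M],
      (ℕ → AddSubgroup M) → Prop,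
    (∀ (M : Type u) [AddCommGroup M] [Module (MvPolynomial σ k) M] (G : ℕ → AddSubgroup M),
      Q M G → LinearCover Q M G) ∧ Q M G

/-- Source of the maps onto the right-hand terms of the exact sequences below, obtained by dividing
by an injection. -/
theorem exists_linearMap_of_forall_mem_range {R A B C : Type*} [Ring R] [AddCommGroup A]
    [AddCommGroup B] [AddCommGroup C] [Module R A] [Module R B] [Module R C] {i : A →ₗ[R] B}
    (hi : Function.Injective i) (h : C →ₗ[R] B) (hr : ∀ c, h c ∈ LinearMap.range i) :
    ∃ g : C →ₗ[R] A, ∀ c, i (g c) = h c :=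
  ⟨(LinearEquiv.ofInjective i hi).symm.toLinearMap ∘ₗ h.codRestrict _ hr, fun c =>
    congrArg Subtype.val ((LinearEquiv.ofInjective i hi).apply_symm_apply ⟨_, hr c⟩)⟩

section Coinduction

variable {σ : Type} {k : Type u} [Field k]

theorem LinearCover.mono
    {Q Q' : ∀ (M : Type u) [AddCommGroup M] [Module (MvPolynomial σ k) M],
      (ℕ → AddSubgroup M) → Prop}
    (h : ∀ (M : Type u) [AddCommGroup M] [Module (MvPolynomial σ k) M] (G : ℕ → AddSubgroup M),
      Q M G → Q' M G)
    {M : Type u} [AddCommGroup M] [Module (MvPolynomial σ k) M] {G : ℕ → AddSubgroup M}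
    (hM : LinearCover Q M G) : LinearCover Q' M G := by
  obtain ⟨ι, i, g, h1, h2, h3⟩ := hM
  exact ⟨ι, i, g, h1, h2, h _ _ h3⟩

theorem LinearlyResolved.linearCover
    {M : Type u} [AddCommGroup M] [Module (MvPolynomial σ k) M] {G : ℕ → AddSubgroup M}
    (hM : LinearlyResolved (σ := σ) (k := k) M G) :
    LinearCover (σ := σ) (k := k) (fun M _ _ G => LinearlyResolved (σ := σ) (k := k) M G) M G := by
  obtain ⟨Q, hQ, h⟩ := hM
  exact (hQ M G h).mono fun M _ _ G hG => ⟨Q, hQ, hG⟩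

/-- Knaster–Tarski: by monotonicity, `LinearCover` of the greatest fixed point is itself an
admissible `Q`. -/
theorem LinearlyResolved.of_linearCover
    {M : Type u} [AddCommGroup M] [Module (MvPolynomial σ k) M] {G : ℕ → AddSubgroup M}
    (hM : LinearCover (σ := σ) (k := k)
      (fun M _ _ G => LinearlyResolved (σ := σ) (k := k) M G) M G) :
    LinearlyResolved (σ := σ) (k := k) M G :=
  ⟨_, fun _ _ _ _ h => h.mono fun _ _ _ _ h => h.linearCover, hM⟩

theorem LinearlyResolved.of_subsingleton
    (M : Type u) [AddCommGroup M] [Module (MvPolynomial σ k) M] (G : ℕ → AddSubgroup M)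
    [Subsingleton M] : LinearlyResolved (σ := σ) (k := k) M G := by
  refine ⟨fun M _ _ _ => Subsingleton M, fun M _ _ G (h : Subsingleton M) => ?_, ‹_›⟩
  refine ⟨Empty, inferInstance, Empty.elim, fun m => ⟨0, Subsingleton.elim _ _⟩, fun j m => ?_, ?_⟩
  · rw [Subsingleton.elim m 0]
    exact ⟨fun _ => ⟨0, fun i => i.elim, Subsingleton.elim _ _⟩, fun _ => zero_mem _⟩
  · infer_instance

end Coinduction

/-! ### Short exact sequences: horseshoe lemma and mapping cone. -/

/-- A short exact sequence `0 → A → B → C → 0` of graded modules, where `A` is shifted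
by `c`. -/
structure GradedShortExact {σ : Type} {k : Type u} [Field k] {A B C : Type u}
    [AddCommGroup A] [AddCommGroup B] [AddCommGroup C] [Module (MvPolynomial σ k) A]
    [Module (MvPolynomial σ k) B] [Module (MvPolynomial σ k) C]
    (c : ℕ) (GA : ℕ → AddSubgroup A) (GB : ℕ → AddSubgroup B) (GC : ℕ → AddSubgroup C)
    (f : A →ₗ[MvPolynomial σ k] B) (g : B →ₗ[MvPolynomial σ k] C) : Prop where
  injective : Function.Injective f
  exact : Function.Exact f g
  surjective : Function.Surjective g
  mem_left : ∀ j a, f a ∈ GB (j + c) ↔ a ∈ GA j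
  mem_right : ∀ j b, b ∈ GB j → g b ∈ GC j
  lift : ∀ j c, c ∈ GC j → ∃ b ∈ GB j, g b = c

section Extensions

variable {σ : Type} {k : Type u} [Field k] {A B C : Type u}
    [AddCommGroup A] [AddCommGroup B] [AddCommGroup C] [Module (MvPolynomial σ k) A]
    [Module (MvPolynomial σ k) B] [Module (MvPolynomial σ k) C]
    {GA : ℕ → AddSubgroup A} {GB : ℕ → AddSubgroup B} {GC : ℕ → AddSubgroup C}
    {f : A →ₗ[MvPolynomial σ k] B} {g : B →ₗ[MvPolynomial σ k] C}

theorem linearCombination_sumElim {ι κ : Type} [Fintype ι] [Fintype κ] (f : A →ₗ[MvPolynomial σ k] B)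
    (gA : ι → A) (b : κ → B) (z : ι ⊕ κ → MvPolynomial σ k) :
    Fintype.linearCombination (MvPolynomial σ k) (Sum.elim (f ∘ gA) b) z =
      f (Fintype.linearCombination (MvPolynomial σ k) gA (z ∘ Sum.inl)) +
      Fintype.linearCombination (MvPolynomial σ k) b (z ∘ Sum.inr) := by
  simp [Fintype.linearCombination_apply, map_sum]

theorem map_linearCombination {κ : Type} [Fintype κ] (g : B →ₗ[MvPolynomial σ k] C)
    (b : κ → B) (z : κ → MvPolynomial σ k) :
    g (Fintype.linearCombination (MvPolynomial σ k) b z) =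
      Fintype.linearCombination (MvPolynomial σ k) (g ∘ b) z := by
  simp [Fintype.linearCombination_apply, map_sum]

theorem linearCombination_mem {κ : Type} [Fintype κ]
    (hB : ∀ j (s : MvPolynomial σ k) (m : B), s.IsHomogeneous j → m ∈ GB 0 → s • m ∈ GB j)
    {b : κ → B} (hb : ∀ i, b i ∈ GB 0) {j : ℕ} {z : κ → MvPolynomial σ k}
    (hz : ∀ i, (z i).IsHomogeneous j) :
    Fintype.linearCombination (MvPolynomial σ k) b z ∈ GB j := by
  rw [Fintype.linearCombination_apply]
  exact sum_mem fun i _ => hB _ _ _ (hz i) (hb i)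

theorem syzygyGrading_smul {ι : Type} (N : Submodule (MvPolynomial σ k) (ι → MvPolynomial σ k))
    (j : ℕ) (s : MvPolynomial σ k) (m : N) (hs : s.IsHomogeneous j)
    (hm : m ∈ syzygyGrading N 0) : s • m ∈ syzygyGrading N j :=
  fun i => hs.mul (by simpa using hm i)

theorem generator_mem {ι : Type} [Fintype ι] {G : ℕ → AddSubgroup A} {g : ι → A}
    (h : ∀ j m, m ∈ G j ↔ ∃ z : ι → MvPolynomial σ k, (∀ i, (z i).IsHomogeneous j) ∧
      Fintype.linearCombination (MvPolynomial σ k) g z = m) (i : ι) : g i ∈ G 0 := by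
  classical
  refine (h 0 _).2 ⟨Pi.single i 1, fun l => ?_, by simp⟩
  obtain rfl | hl := eq_or_ne l i
  · simpa using isHomogeneous_one σ k
  · simpa [hl] using isHomogeneous_zero σ k 0

/-- The horseshoe lemma for linear resolutions. -/
theorem LinearlyResolved.extension
    (hA : LinearlyResolved (σ := σ) (k := k) A GA) (hC : LinearlyResolved (σ := σ) (k := k) C GC)
    (hB : ∀ j (s : MvPolynomial σ k) (m : B), s.IsHomogeneous j → m ∈ GB 0 → s • m ∈ GB j)
    (h : GradedShortExact 0 GA GB GC f g) : LinearlyResolved (σ := σ) (k := k) B GB := by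
  -- Coinduction with `Q` = "middle term of such a sequence": the syzygy modules form a sequence of
  -- the same kind.
  refine ⟨fun B _ _ GB => ∃ (A C : Type u) (_ : AddCommGroup A) (_ : AddCommGroup C)
    (_ : Module (MvPolynomial σ k) A) (_ : Module (MvPolynomial σ k) C)
    (GA : ℕ → AddSubgroup A) (GC : ℕ → AddSubgroup C)
    (f : A →ₗ[MvPolynomial σ k] B) (g : B →ₗ[MvPolynomial σ k] C),
    LinearlyResolved (σ := σ) (k := k) A GA ∧ LinearlyResolved (σ := σ) (k := k) C GC ∧
    (∀ j (s : MvPolynomial σ k) (m : B), s.IsHomogeneous j → m ∈ GB 0 → s • m ∈ GB j) ∧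
    GradedShortExact 0 GA GB GC f g, ?_, A, C, _, _, _, _, GA, GC, f, g, hA, hC, hB, h⟩
  clear hA hC hB h
  rintro B _ _ GB ⟨A, C, _, _, _, _, GA, GC, f, g, hA, hC, hB, h⟩
  obtain ⟨ι, _, gA, sA, mA, kA⟩ := hA.linearCover
  obtain ⟨κ, _, gC, sC, mC, kC⟩ := hC.linearCover
  choose b hb hgb using fun i => h.lift 0 (gC i) (generator_mem mC i)
  have hgb' : g ∘ b = gC := funext hgb
  have hgf : ∀ a, g (f a) = 0 := h.exact.apply_apply_eq_zero
  have hlift : ∀ j (m : B), m ∈ GB j → g m = 0 → ∃ z : ι → MvPolynomial σ k,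
      (∀ i, (z i).IsHomogeneous j) ∧
      f (Fintype.linearCombination (MvPolynomial σ k) gA z) = m := by
    intro j m hm hg
    obtain ⟨a, rfl⟩ := (h.exact m).1 hg
    obtain ⟨z, hz, rfl⟩ := (mA j a).1 ((h.mem_left j a).1 hm)
    exact ⟨z, hz, rfl⟩
  have hlift' : ∀ (m : B), g m = 0 → ∃ z : ι → MvPolynomial σ k,
      f (Fintype.linearCombination (MvPolynomial σ k) gA z) = m := by
    intro m hg
    obtain ⟨a, rfl⟩ := (h.exact m).1 hg
    obtain ⟨z, rfl⟩ := sA a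
    exact ⟨z, rfl⟩
  refine ⟨ι ⊕ κ, inferInstance, Sum.elim (f ∘ gA) b, ?_, ?_, ?_⟩
  · intro m
    obtain ⟨w, hw⟩ := sC (g m)
    obtain ⟨z, hz⟩ := hlift' (m - Fintype.linearCombination (MvPolynomial σ k) b w)
      (by rw [map_sub, map_linearCombination, hgb', hw, sub_self])
    exact ⟨Sum.elim z w, by simp [linearCombination_sumElim, hz]⟩
  · intro j m
    constructor
    · intro hm
      obtain ⟨w, hw, hw'⟩ := (mC j _).1 (h.mem_right j m hm)
      obtain ⟨z, hz, hz'⟩ := hlift j (m - Fintype.linearCombination (MvPolynomial σ k) b w)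
        (sub_mem hm (linearCombination_mem hB hb hw))
        (by rw [map_sub, map_linearCombination, hgb', hw', sub_self])
      exact ⟨Sum.elim z w, Sum.rec hz hw, by simp [linearCombination_sumElim, hz']⟩
    · rintro ⟨z, hz, rfl⟩
      refine linearCombination_mem hB (Sum.rec (fun i => ?_) hb) hz
      exact (h.mem_left 0 _).2 (generator_mem mA i)
  · let F : (ι → MvPolynomial σ k) →ₗ[MvPolynomial σ k] (ι ⊕ κ → MvPolynomial σ k) :=
      { toFun := fun z => Sum.elim z 0
        map_add' := fun x y => by ext i : 1; cases i <;> simp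
        map_smul' := fun x y => by ext i : 1; cases i <;> simp }
    let P : (ι ⊕ κ → MvPolynomial σ k) →ₗ[MvPolynomial σ k] (κ → MvPolynomial σ k) :=
      LinearMap.funLeft (MvPolynomial σ k) _ Sum.inr
    have hF : ∀ z ∈ LinearMap.ker (Fintype.linearCombination (MvPolynomial σ k) gA),
        F z ∈ LinearMap.ker
          (Fintype.linearCombination (MvPolynomial σ k) (Sum.elim (f ∘ gA) b)) := by
      intro z hz
      rw [LinearMap.mem_ker] at hz ⊢
      simp [F, linearCombination_sumElim, hz]
    have hP : ∀ z ∈ LinearMap.ker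
          (Fintype.linearCombination (MvPolynomial σ k) (Sum.elim (f ∘ gA) b)),
        P z ∈ LinearMap.ker (Fintype.linearCombination (MvPolynomial σ k) gC) := by
      intro z hz
      rw [LinearMap.mem_ker] at hz ⊢
      have := congrArg g hz
      rwa [linearCombination_sumElim, map_add, hgf, zero_add, map_linearCombination, hgb',
        map_zero] at this
    -- The syzygies of `gA`, of the joint family and of `gC` form the next short exact sequence.
    refine ⟨_, _, _, _, _, _, _, _, F.restrict hF, P.restrict hP, kA, kC, syzygyGrading_smul _,
      ?_, ?_, ?_, ?_, ?_, ?_⟩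
    · intro x y hxy
      ext i : 2
      exact congrFun (congrArg Subtype.val hxy) (Sum.inl i)
    · rintro ⟨z, hz⟩
      constructor
      · intro h0
        have h0' : z ∘ Sum.inr = 0 := congrArg Subtype.val h0
        rw [LinearMap.mem_ker, linearCombination_sumElim, h0', map_zero, add_zero,
          map_eq_zero_iff f h.injective] at hz
        refine ⟨⟨z ∘ Sum.inl, hz⟩, Subtype.ext (funext ?_)⟩
        rintro (i | i)
        · rfl
        · exact (congrFun h0' i).symm
      · rintro ⟨y, hy⟩
        rw [← hy]
        rfl
    · rintro ⟨w, hw⟩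
      rw [LinearMap.mem_ker] at hw
      obtain ⟨z, hz⟩ := hlift' (Fintype.linearCombination (MvPolynomial σ k) b w)
        (by rw [map_linearCombination, hgb', hw])
      -- A syzygy `w` of `gC` gives a combination of the lifts `b` lying in the image of `A`; `-z`
      -- cancels it.
      refine ⟨⟨Sum.elim (-z) w, ?_⟩, Subtype.ext rfl⟩
      rw [LinearMap.mem_ker, linearCombination_sumElim]
      simp [hz]
    · rintro j z
      refine ⟨fun hz i => hz (Sum.inl i), fun hz => Sum.rec hz fun i => isHomogeneous_zero _ _ _⟩
    · exact fun j z hz i => hz (Sum.inr i)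
    · rintro j ⟨w, hw⟩ hwj
      rw [LinearMap.mem_ker] at hw
      obtain ⟨z, hz, hz'⟩ := hlift (j + 1) (Fintype.linearCombination (MvPolynomial σ k) b w)
        (linearCombination_mem hB hb hwj)
        (by rw [map_linearCombination, hgb', hw])
      refine ⟨⟨Sum.elim (-z) w, ?_⟩, Sum.rec (fun i => (hz i).neg) hwj, Subtype.ext rfl⟩
      rw [LinearMap.mem_ker, linearCombination_sumElim]
      simp [hz']

/-- The mapping cone of a degree one injection between linearly resolved modules. -/
theorem LinearlyResolved.cokernel
    (hA : LinearlyResolved (σ := σ) (k := k) A GA) (hB : LinearlyResolved (σ := σ) (k := k) B GB)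
    (h : GradedShortExact 1 GA GB GC f g) : LinearlyResolved (σ := σ) (k := k) C GC := by
  obtain ⟨ι, _, gB, sB, mB, kB⟩ := hB.linearCover
  refine .of_linearCover ⟨ι, inferInstance, g ∘ gB, ?_, ?_, ?_⟩
  · intro c
    obtain ⟨m, rfl⟩ := h.surjective c
    obtain ⟨z, rfl⟩ := sB m
    exact ⟨z, (map_linearCombination _ _ _).symm⟩
  · intro j c
    constructor
    · intro hc
      obtain ⟨m, hm, rfl⟩ := h.lift j c hc
      obtain ⟨z, hz, rfl⟩ := (mB j m).1 hm
      exact ⟨z, hz, (map_linearCombination _ _ _).symm⟩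
    · rintro ⟨z, hz, rfl⟩
      rw [← map_linearCombination]
      exact h.mem_right _ _ ((mB _ _).2 ⟨z, hz, rfl⟩)
  · have hker : ∀ z : LinearMap.ker (Fintype.linearCombination (MvPolynomial σ k) (g ∘ gB)),
        Fintype.linearCombination (MvPolynomial σ k) gB z ∈ LinearMap.range f := by
      rintro ⟨z, hz⟩
      rw [LinearMap.mem_ker, ← map_linearCombination] at hz
      exact (h.exact _).1 hz
    obtain ⟨p, hp⟩ := exists_linearMap_of_forall_mem_range h.injective
      (Fintype.linearCombination (MvPolynomial σ k) gB ∘ₗ Submodule.subtype _) hker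
    replace hp : ∀ z, f (p z) = Fintype.linearCombination (MvPolynomial σ k) gB z := hp
    have hle : LinearMap.ker (Fintype.linearCombination (MvPolynomial σ k) gB) ≤
        LinearMap.ker (Fintype.linearCombination (MvPolynomial σ k) (g ∘ gB)) := by
      intro z hz
      rw [LinearMap.mem_ker] at hz ⊢
      rw [← map_linearCombination, hz, map_zero]
    have hlift : ∀ a z, Fintype.linearCombination (MvPolynomial σ k) gB z = f a →
        ∃ hz : z ∈ LinearMap.ker (Fintype.linearCombination (MvPolynomial σ k) (g ∘ gB)),
          p ⟨z, hz⟩ = a := by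
      intro a z hz
      refine ⟨?_, h.injective (by rw [hp, hz])⟩
      rw [LinearMap.mem_ker, ← map_linearCombination, hz]
      exact h.exact.apply_apply_eq_zero a
    refine LinearlyResolved.extension (f := Submodule.inclusion hle) (g := p) kB hA
      (syzygyGrading_smul _) ⟨Submodule.inclusion_injective hle, ?_, ?_, ?_, ?_, ?_⟩
    · intro z
      rw [← map_eq_zero_iff f h.injective, hp]
      constructor
      · exact fun hz => ⟨⟨z, hz⟩, rfl⟩
      · rintro ⟨y, rfl⟩
        exact y.2
    · intro a
      obtain ⟨z, hz⟩ := sB (f a)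
      obtain ⟨hz', h'⟩ := hlift a z hz
      exact ⟨_, h'⟩
    · exact fun j z => Iff.rfl
    · intro j z hz
      rw [← h.mem_left, hp]
      exact (mB _ _).2 ⟨z, hz, rfl⟩
    · intro j a ha
      obtain ⟨z, hz, hz'⟩ := (mB _ _).1 ((h.mem_left j a).2 ha)
      obtain ⟨hz'', h'⟩ := hlift a z hz'
      exact ⟨⟨z, hz''⟩, hz, h'⟩

end Extensions

/-! ### Linear quotients. -/

/-- The grading on an ideal, shifted so that degree `c` becomes degree `0`. -/
noncomputable def idealGrading {σ : Type} {k : Type u} [Field k] (I : Ideal (MvPolynomial σ k)) (c j : ℕ) :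
    AddSubgroup I where
  carrier := {f | f.1.IsHomogeneous (j + c)}
  add_mem' ha hb := ha.add hb
  zero_mem' := isHomogeneous_zero _ _ _
  neg_mem' ha := ha.neg

/-- The grading on the quotient by an ideal. -/
noncomputable def quotientGrading {σ : Type} {k : Type u} [Field k] (I : Ideal (MvPolynomial σ k)) (j : ℕ) :
    AddSubgroup (MvPolynomial σ k ⧸ I) :=
  (homogeneousSubmodule σ k j).toAddSubgroup.map (Ideal.Quotient.mk I).toAddMonoidHom

section LinearQuotients

variable {σ : Type} {k : Type u} [Field k]

theorem mem_quotientGrading {I : Ideal (MvPolynomial σ k)} {j : ℕ} {x : MvPolynomial σ k ⧸ I} :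
    x ∈ quotientGrading I j ↔ ∃ s : MvPolynomial σ k, s.IsHomogeneous j ∧
      Ideal.Quotient.mk I s = x := Iff.rfl

theorem homogeneousComponent_mul_of_isHomogeneous {p : MvPolynomial σ k} {d : ℕ}
    (hp : p.IsHomogeneous d) (s : MvPolynomial σ k) (j : ℕ) :
    homogeneousComponent (j + d) (s * p) = homogeneousComponent j s * p := by
  rw [← decomposition.decompose'_apply, ← decomposition.decompose'_apply]
  exact DirectSum.coe_decompose_mul_add_of_right_mem (homogeneousSubmodule σ k) (i := j) (a := s)
      (j := d) hp

theorem isHomogeneous_span_X (T : Set σ) :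
    (Ideal.span ((X : σ → MvPolynomial σ k) '' T)).IsHomogeneous (homogeneousSubmodule σ k) := by
  refine Ideal.homogeneous_span _ _ ?_
  rintro _ ⟨i, -, rfl⟩
  exact ⟨1, isHomogeneous_X k i⟩

theorem isHomogeneous_span_monomial (E : Set (σ →₀ ℕ)) :
    (Ideal.span ((fun α => monomial α (1 : k)) '' E)).IsHomogeneous
      (homogeneousSubmodule σ k) := by
  refine Ideal.homogeneous_span _ _ ?_
  rintro _ ⟨α, -, rfl⟩
  exact ⟨α.degree, isHomogeneous_monomial 1 rfl⟩

theorem linearlyResolved_quotient_bot :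
    LinearlyResolved (σ := σ) (k := k) (MvPolynomial σ k ⧸ (⊥ : Ideal (MvPolynomial σ k)))
      (quotientGrading ⊥) := by
  have hφ : ∀ z : Unit → MvPolynomial σ k, Fintype.linearCombination (MvPolynomial σ k)
      (fun _ : Unit => (1 : MvPolynomial σ k ⧸ (⊥ : Ideal (MvPolynomial σ k)))) z =
      Ideal.Quotient.mk ⊥ (z ()) := by
    intro z
    simp [Fintype.linearCombination_apply, Algebra.smul_def]
  refine .of_linearCover ⟨Unit, inferInstance, fun _ => 1, fun m => ?_, fun j m => ?_, ?_⟩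
  · obtain ⟨s, rfl⟩ := Ideal.Quotient.mk_surjective m
    exact ⟨fun _ => s, hφ _⟩
  · rw [mem_quotientGrading]
    constructor
    · rintro ⟨s, hs, rfl⟩
      exact ⟨fun _ => s, fun _ => hs, hφ _⟩
    · rintro ⟨z, hz, rfl⟩
      exact ⟨z (), hz (), (hφ z).symm⟩
  · have : Subsingleton (LinearMap.ker (Fintype.linearCombination (MvPolynomial σ k)
        (fun _ : Unit => (1 : MvPolynomial σ k ⧸ (⊥ : Ideal (MvPolynomial σ k)))))) := by
      rw [Submodule.subsingleton_iff_eq_bot, eq_bot_iff]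
      intro z hz
      rw [LinearMap.mem_ker, hφ, Ideal.Quotient.eq_zero_iff_mem, Ideal.mem_bot] at hz
      exact funext fun _ => hz
    exact .of_subsingleton _ _

/-- The quotient of the polynomial ring by finitely many variables has a linear resolution. -/
theorem linearlyResolved_quotient_span_X {T : Set σ} (hT : T.Finite) :
    LinearlyResolved (σ := σ) (k := k)
      (MvPolynomial σ k ⧸ Ideal.span ((X : σ → MvPolynomial σ k) '' T))
      (quotientGrading _) := by
  induction T, hT using Set.Finite.induction_on with
  | empty =>
    rw [Set.image_empty, Ideal.span_empty]
    exact linearlyResolved_quotient_bot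
  | @insert x T hx hT ih =>
    set L := Ideal.span ((X : σ → MvPolynomial σ k) '' T) with hL
    set L' := Ideal.span ((X : σ → MvPolynomial σ k) '' insert x T) with hL'
    have hle : L ≤ L' := Ideal.span_mono (Set.image_mono (Set.subset_insert _ _))
    -- As `x ∉ T`, the variable `X x` is a nonzerodivisor modulo `L`, so multiplication by it is
    -- injective on `S/L`, with cokernel `S/L'`.
    have hmem : ∀ s, s * X x ∈ L → s ∈ L := by
      intro s hs
      rw [hL, mem_ideal_span_X_image] at hs ⊢
      intro m hm
      obtain ⟨i, hi, hmi⟩ := hs (m + Finsupp.single x 1) (by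
        rw [mul_comm, support_X_mul, Finset.mem_map]
        exact ⟨m, hm, add_comm _ _⟩)
      have hix : x ≠ i := fun h => hx (h ▸ hi)
      exact ⟨i, hi, by simpa [Finsupp.single_apply, hix] using hmi⟩
    let f : (MvPolynomial σ k ⧸ L) →ₗ[MvPolynomial σ k] (MvPolynomial σ k ⧸ L) :=
      LinearMap.mulRight (MvPolynomial σ k) (Ideal.Quotient.mk L (X x))
    have hf : ∀ s, f (Ideal.Quotient.mk L s) = Ideal.Quotient.mk L (s * X x) := by
      intro s
      simp [f]
    let g : (MvPolynomial σ k ⧸ L) →ₗ[MvPolynomial σ k] (MvPolynomial σ k ⧸ L') :=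
      (Ideal.Quotient.factorₐ (MvPolynomial σ k) hle).toLinearMap
    have hg : ∀ s, g (Ideal.Quotient.mk L s) = Ideal.Quotient.mk L' s := fun s => rfl
    refine LinearlyResolved.cokernel (f := f) (g := g) ih ih ⟨?_, ?_, ?_, ?_, ?_, ?_⟩
    · rw [injective_iff_map_eq_zero]
      intro y hy
      obtain ⟨s, rfl⟩ := Ideal.Quotient.mk_surjective y
      rw [hf, Ideal.Quotient.eq_zero_iff_mem] at hy
      exact Ideal.Quotient.eq_zero_iff_mem.2 (hmem s hy)
    · intro y
      obtain ⟨s, rfl⟩ := Ideal.Quotient.mk_surjective y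
      rw [hg, Ideal.Quotient.eq_zero_iff_mem, hL', Set.image_insert_eq, Ideal.mem_span_insert]
      constructor
      · rintro ⟨a, z, hz, rfl⟩
        refine ⟨Ideal.Quotient.mk L a, ?_⟩
        rw [hf, Ideal.Quotient.eq]
        simpa using hz
      · rintro ⟨w, hw⟩
        obtain ⟨a, rfl⟩ := Ideal.Quotient.mk_surjective w
        rw [hf, eq_comm, Ideal.Quotient.eq] at hw
        exact ⟨a, _, hw, by ring⟩
    · intro y
      obtain ⟨s, rfl⟩ := Ideal.Quotient.mk_surjective y
      exact ⟨Ideal.Quotient.mk L s, rfl⟩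
    · intro j y
      obtain ⟨s, rfl⟩ := Ideal.Quotient.mk_surjective y
      rw [hf]
      constructor
      · rintro ⟨t, ht, hts⟩
        have hts' : t - s * X x ∈ L := Ideal.Quotient.eq.1 hts
        refine ⟨homogeneousComponent j s, homogeneousComponent_isHomogeneous j s,
          Ideal.Quotient.eq.2 (hmem _ ?_)⟩
        -- Comparing parts of degree `j + 1`: since `L` is homogeneous, only the degree `j` part of
        -- `s` matters modulo `L`.
        have h1 := homogeneousComponent_mem_of_mem (isHomogeneous_span_X T) hts' (j + 1)
        rw [map_sub, homogeneousComponent_mul_of_isHomogeneous (isHomogeneous_X k x),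
          homogeneousComponent_eq_self ht] at h1
        convert L.sub_mem hts' h1 using 1
        ring
      · rintro ⟨t, ht, hts⟩
        refine ⟨t * X x, ht.mul (isHomogeneous_X k x), ?_⟩
        change Ideal.Quotient.mk L _ = _
        change Ideal.Quotient.mk L _ = _ at hts
        rw [map_mul, hts, map_mul]
    · rintro j _ ⟨s, hs, rfl⟩
      exact ⟨s, hs, rfl⟩
    · rintro j _ ⟨s, hs, rfl⟩
      exact ⟨Ideal.Quotient.mk L s, ⟨s, hs, rfl⟩, rfl⟩

/-- Adding a generator of degree `d` to a linearly resolved ideal generated in degree `d`. -/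
theorem LinearlyResolved.sup_span_singleton {J L : Ideal (MvPolynomial σ k)}
    {p : MvPolynomial σ k} {d : ℕ} (hJ : J.IsHomogeneous (homogeneousSubmodule σ k))
    (hp : p.IsHomogeneous d) (hL : ∀ s, s * p ∈ J ↔ s ∈ L)
    (rJ : LinearlyResolved (σ := σ) (k := k) J (idealGrading J d))
    (rL : LinearlyResolved (σ := σ) (k := k) (MvPolynomial σ k ⧸ L) (quotientGrading L)) :
    LinearlyResolved (σ := σ) (k := k) ↥(J ⊔ Ideal.span {p})
      (idealGrading (J ⊔ Ideal.span {p}) d) := by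
  -- Multiplication by `p` identifies `S/L` with `(J + (p))/J`; `g` below is the quotient map read
  -- through this identification.
  let q : MvPolynomial σ k →ₗ[MvPolynomial σ k] (MvPolynomial σ k ⧸ J) :=
    J.mkQ ∘ₗ LinearMap.toSpanSingleton (MvPolynomial σ k) (MvPolynomial σ k) p
  have hq : ∀ s, q s = Ideal.Quotient.mk J (s * p) := fun s => rfl
  have hqL : LinearMap.ker q = L := by
    ext s
    rw [LinearMap.mem_ker, hq, Ideal.Quotient.eq_zero_iff_mem, hL]
  let i : (MvPolynomial σ k ⧸ L) →ₗ[MvPolynomial σ k] (MvPolynomial σ k ⧸ J) :=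
    Submodule.liftQ L q hqL.ge
  have hi : Function.Injective i := LinearMap.ker_eq_bot.1 (Submodule.ker_liftQ_eq_bot _ _ _ hqL.le)
  have hi' : ∀ s, i (Ideal.Quotient.mk L s) = Ideal.Quotient.mk J (s * p) := fun s => rfl
  have hdec : ∀ y ∈ J ⊔ Ideal.span {p}, ∃ s, y - s * p ∈ J := by
    intro y hy
    obtain ⟨a, ha, b, hb, rfl⟩ := Submodule.mem_sup.1 hy
    obtain ⟨s, rfl⟩ := Ideal.mem_span_singleton'.1 hb
    exact ⟨s, by simpa using ha⟩
  obtain ⟨g, hg⟩ := exists_linearMap_of_forall_mem_range hi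
    (J.mkQ ∘ₗ Submodule.subtype (J ⊔ Ideal.span {p})) (by
      rintro ⟨y, hy⟩
      obtain ⟨s, hs⟩ := hdec y hy
      exact ⟨Ideal.Quotient.mk L s, (Ideal.Quotient.eq.2 hs).symm⟩)
  replace hg : ∀ y, i (g y) = Ideal.Quotient.mk J y.1 := hg
  have hgs : ∀ y s, g y = Ideal.Quotient.mk L s ↔ y.1 - s * p ∈ J := by
    intro y s
    rw [← hi.eq_iff, hg, hi', Ideal.Quotient.eq]
  have hpm : ∀ s, s * p ∈ J ⊔ Ideal.span {p} := fun s =>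
    Ideal.mem_sup_right (Ideal.mul_mem_left _ _ (Ideal.mem_span_singleton_self p))
  have hgp : ∀ s, g ⟨s * p, hpm s⟩ = Ideal.Quotient.mk L s := by
    intro s
    simp [hgs]
  refine LinearlyResolved.extension (f := Submodule.inclusion le_sup_left) (g := g) rJ rL ?_
    ⟨Submodule.inclusion_injective _, ?_, ?_, ?_, ?_, ?_⟩
  · intro j s m hs hm
    exact hs.mul (show m.1.IsHomogeneous d from Nat.zero_add d ▸ hm)
  · intro y
    have := hgs y 0
    rw [map_zero, zero_mul, sub_zero] at this
    rw [this]
    constructor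
    · exact fun hy => ⟨⟨_, hy⟩, rfl⟩
    · rintro ⟨z, rfl⟩
      exact z.2
  · intro c
    obtain ⟨s, rfl⟩ := Ideal.Quotient.mk_surjective c
    exact ⟨_, hgp s⟩
  · exact fun j a => Iff.rfl
  · rintro j ⟨y, hy⟩ (hyj : y.IsHomogeneous (j + d))
    obtain ⟨s, hs⟩ := hdec y hy
    refine ⟨homogeneousComponent j s, homogeneousComponent_isHomogeneous j s, Eq.symm ?_⟩
    refine (hgs _ _).2 ?_
    have h1 := homogeneousComponent_mem_of_mem hJ hs (j + d)
    rwa [map_sub, homogeneousComponent_mul_of_isHomogeneous hp,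
      homogeneousComponent_eq_self hyj] at h1
  · rintro j _ ⟨s, hs, rfl⟩
    exact ⟨_, IsHomogeneous.mul hs hp, hgp s⟩

/-- Monomial ideals generated in one degree with linear quotients have a linear resolution. -/
theorem linearlyResolved_span_monomial [Finite σ] {α : Type} [LinearOrder α] {d : ℕ}
    (w : α → σ →₀ ℕ) (E : Finset α) (hd : ∀ x ∈ E, (w x).degree = d)
    (hE : ∀ x ∈ E, ∀ y ∈ E, x < y → ∃ i, w x i < w y i ∧ ∃ z ∈ E, x < z ∧
      w z ≤ w x + Finsupp.single i 1) :
    LinearlyResolved (σ := σ) (k := k)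
      (Ideal.span ((fun m => monomial m (1 : k)) '' (w '' (E : Set α)))) (idealGrading _ d) := by
  induction E using Finset.induction_on_min with
  | empty =>
    have : Subsingleton (Ideal.span ((fun m => monomial m (1 : k)) ''
        (w '' ((∅ : Finset α) : Set α)))) := by
      rw [Submodule.subsingleton_iff_eq_bot]
      simp
    exact .of_subsingleton _ _
  | insert a E ha ih =>
    have hE' : ∀ x ∈ E, ∀ y ∈ E, x < y → ∃ i, w x i < w y i ∧ ∃ z ∈ E, x < z ∧
        w z ≤ w x + Finsupp.single i 1 := by
      intro x hx y hy hxy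
      obtain ⟨i, hi, z, hz, hxz, h⟩ := hE x (Finset.mem_insert_of_mem hx) y
        (Finset.mem_insert_of_mem hy) hxy
      refine ⟨i, hi, z, ?_, hxz, h⟩
      rcases Finset.mem_insert.1 hz with rfl | hz
      · exact absurd (ha x hx) hxz.not_gt
      · exact hz
    have hmain := LinearlyResolved.sup_span_singleton (k := k) (isHomogeneous_span_monomial _)
      (isHomogeneous_monomial (1 : k) (hd a (Finset.mem_insert_self a E)))
      -- The minimum is inserted last, so `E` holds the larger monomials; these variables generate
      -- the colon ideal by `w a`.
      (L := Ideal.span (X '' {i | ∃ z ∈ E, w z ≤ w a + Finsupp.single i 1})) ?_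
      (ih (fun x hx => hd x (Finset.mem_insert_of_mem hx)) hE')
      (linearlyResolved_quotient_span_X (Set.toFinite _))
    · convert hmain using 2 <;>
      rw [Finset.coe_insert, Set.image_insert_eq, Set.image_insert_eq, Ideal.span_insert, sup_comm]
    · intro s
      rw [mem_ideal_span_monomial_image, mem_ideal_span_X_image]
      constructor
      · intro h m hm
        obtain ⟨_, ⟨y, hy, rfl⟩, hle⟩ := h (m + w a) (by
          rw [mem_support_iff, coeff_mul_monomial, mul_one]
          exact mem_support_iff.1 hm)
        obtain ⟨i, hi, z, hz, haz, hza⟩ := hE a (Finset.mem_insert_self a E) y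
          (Finset.mem_insert_of_mem hy) (ha y hy)
        refine ⟨i, ⟨z, ?_, hza⟩, ?_⟩
        · exact Finset.mem_of_mem_insert_of_ne hz haz.ne'
        -- From `w a i < w y i ≤ m i + w a i` it follows that `X i` divides the monomial `m`.
        · have := hle i
          rw [Finsupp.add_apply] at this
          omega
      · intro h m hm
        rw [mem_support_iff, coeff_mul_monomial'] at hm
        obtain ⟨hle, hm⟩ := ite_ne_right_iff.1 hm
        rw [mul_one] at hm
        obtain ⟨i, ⟨z, hz, hza⟩, hi⟩ := h _ (mem_support_iff.2 hm)
        refine ⟨_, ⟨z, hz, rfl⟩, hza.trans ?_⟩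
        calc w a + Finsupp.single i 1 ≤ w a + (m - w a) := by
              gcongr
              rw [Finsupp.single_le_iff]
              omega
          _ = m := add_tsub_cancel_of_le hle

end LinearQuotients

/-! ### From iterated syzygies to a minimal graded free resolution. -/

/-- A submodule of a finite free module all of whose syzygies are linear. -/
structure LinearSyzygyModule (σ : Type) (k : Type u) [Field k] where
  /-- index set of the basis of the free module -/
  ι : Type
  [fintype : Fintype ι]
  /-- the submodule -/
  N : Submodule (MvPolynomial σ k) (ι → MvPolynomial σ k)
  /-- the submodule has a linear resolution -/
  resolved : LinearlyResolved (σ := σ) (k := k) N (syzygyGrading N)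

attribute [instance] LinearSyzygyModule.fintype

namespace LinearSyzygyModule

variable {σ : Type} {k : Type u} [Field k]

/-- Bundling the index type with the submodule makes the columns of each matrix the rows of the next
one definitionally. -/
theorem exists_next (s : LinearSyzygyModule σ k) :
    ∃ (t : LinearSyzygyModule σ k) (g : t.ι → s.N), (∀ i, g i ∈ syzygyGrading s.N 0) ∧
      Function.Surjective (Fintype.linearCombination (MvPolynomial σ k) g) ∧
      t.N = LinearMap.ker (Fintype.linearCombination (MvPolynomial σ k) g) := by
  obtain ⟨ι, _, g, hs, hm, hk⟩ := s.resolved.linearCover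
  exact ⟨⟨ι, _, hk⟩, g, generator_mem hm, hs, rfl⟩

/-- The module of relations between the minimal generators. -/
noncomputable def next (s : LinearSyzygyModule σ k) : LinearSyzygyModule σ k :=
  s.exists_next.choose

/-- The minimal generators. -/
noncomputable def generators (s : LinearSyzygyModule σ k) : s.next.ι → s.N :=
  s.exists_next.choose_spec.choose

theorem generators_spec (s : LinearSyzygyModule σ k) :
    (∀ i, s.generators i ∈ syzygyGrading s.N 0) ∧
      Function.Surjective (Fintype.linearCombination (MvPolynomial σ k) s.generators) ∧
      s.next.N = LinearMap.ker (Fintype.linearCombination (MvPolynomial σ k) s.generators) :=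
  s.exists_next.choose_spec.choose_spec

/-- The minimal generators, as the columns of a matrix. -/
noncomputable def matrix (s : LinearSyzygyModule σ k) :
    Matrix s.ι s.next.ι (MvPolynomial σ k) :=
  fun p q => (s.generators q).1 p

theorem matrix_isHomogeneous (s : LinearSyzygyModule σ k) (p : s.ι) (q : s.next.ι) :
    (s.matrix p q).IsHomogeneous 1 :=
  s.generators_spec.1 q p

theorem mulVec_matrix (s : LinearSyzygyModule σ k) (z : s.next.ι → MvPolynomial σ k) :
    s.matrix.mulVec z =
      (Fintype.linearCombination (MvPolynomial σ k) s.generators z).1 := by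
  ext1 p
  simp [Matrix.mulVec, dotProduct, Fintype.linearCombination_apply, matrix, mul_comm]

theorem range_matrix (s : LinearSyzygyModule σ k) : LinearMap.range s.matrix.mulVecLin = s.N := by
  ext y
  constructor
  · rintro ⟨z, rfl⟩
    rw [Matrix.mulVecLin_apply, mulVec_matrix]
    exact Subtype.property _
  · intro hy
    obtain ⟨z, hz⟩ := s.generators_spec.2.1 ⟨y, hy⟩
    exact ⟨z, by rw [Matrix.mulVecLin_apply, mulVec_matrix, hz]⟩

theorem ker_matrix (s : LinearSyzygyModule σ k) :
    LinearMap.ker s.matrix.mulVecLin = s.next.N := by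
  rw [s.generators_spec.2.2]
  ext z
  rw [LinearMap.mem_ker, LinearMap.mem_ker, Matrix.mulVecLin_apply, mulVec_matrix,
    ZeroMemClass.coe_eq_zero]

/-- The sequence of iterated modules of relations. -/
noncomputable def iterate (s : LinearSyzygyModule σ k) : ℕ → LinearSyzygyModule σ k
  | 0 => s
  | i + 1 => (s.iterate i).next

end LinearSyzygyModule

/-- All matrix entries are linear forms, which yields both the shifts `c + i` and minimality. -/
theorem LinearlyResolved.hasLinearResolution {σ : Type} {k : Type u} [Field k]
    {I : Ideal (MvPolynomial σ k)} {c : ℕ}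
    (h : LinearlyResolved (σ := σ) (k := k) I (idealGrading I c)) : HasLinearResolution I := by
  obtain ⟨ι, _, g, hs, hm, hk⟩ := h.linearCover
  have hg : Fintype.linearCombination (MvPolynomial σ k) (fun i => (g i).1) =
      I.subtype ∘ₗ Fintype.linearCombination (MvPolynomial σ k) g := by
    ext1 z
    simp [Fintype.linearCombination_apply]
  let s : LinearSyzygyModule σ k := ⟨ι, _, hk⟩
  refine ⟨{ ι := fun i => (s.iterate i).ι
            shift := fun i _ => c + i
            gen := fun i => (g i).1
            diff := fun i => (s.iterate i).matrix
            gen_homogeneous := fun i => ?_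
            diff_homogeneous := fun i p q =>
              Or.inr ⟨1, rfl, LinearSyzygyModule.matrix_isHomogeneous _ p q⟩
            range_gen := ?_
            exact_zero := ?_
            exact_succ := fun i => ?_
            minimal := fun i p q => ?_ }, c, fun _ _ => rfl⟩
  · have : (g i).1.IsHomogeneous (0 + c) := generator_mem hm i
    rwa [zero_add] at this
  · refine (congrArg LinearMap.range hg).trans ?_
    rw [LinearMap.range_comp, LinearMap.range_eq_top.2 hs, Submodule.map_top,
      Submodule.range_subtype]
  · refine LinearMap.exact_iff.2 (Eq.trans ?_ (LinearSyzygyModule.range_matrix s).symm)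
    refine (congrArg LinearMap.ker hg).trans ?_
    rw [LinearMap.ker_comp, Submodule.ker_subtype]
    rfl
  · exact LinearMap.exact_iff.2 ((s.iterate i).ker_matrix.trans
      (LinearSyzygyModule.range_matrix _).symm)
  · rw [constantCoeff_eq]
    exact ((s.iterate i).matrix_isHomogeneous p q).coeff_eq_zero (by simp)

/-! ### Monomial ideals and the exchange property. -/

section MonomialIdeals

variable {σ : Type} {k : Type u} [Field k]

/-- All monomials of the power are listed, not only minimal generators, so that the exponent set is
upward closed. -/
theorem span_X_image_pow [Fintype σ] (s : Finset σ) (r : ℕ) :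
    Ideal.span ((X : σ → MvPolynomial σ k) '' s) ^ r =
      Ideal.span ((fun m => monomial m (1 : k)) '' {m : σ →₀ ℕ | r ≤ ∑ i ∈ s, m i}) := by
  classical
  apply le_antisymm
  · induction r with
    | zero =>
      rw [pow_zero, Ideal.one_eq_top, top_le_iff, Ideal.eq_top_iff_one]
      exact Ideal.subset_span ⟨0, Nat.zero_le _, rfl⟩
    | succ r ih =>
      rw [pow_succ]
      refine (Ideal.mul_mono_left ih).trans ?_
      rw [Ideal.span_mul_span', Ideal.span_le]
      rintro _ ⟨_, ⟨m, hm, rfl⟩, _, ⟨i, hi, rfl⟩, rfl⟩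
      refine Ideal.subset_span ⟨m + Finsupp.single i 1, ?_, ?_⟩
      · have hm' : r ≤ ∑ i ∈ s, m i := hm
        have hi' : i ∈ s := hi
        simpa [Finset.sum_add_distrib, Finsupp.single_apply, hi'] using hm'
      · simp [X, monomial_mul]
  · rw [Ideal.span_le]
    rintro _ ⟨m, hm, rfl⟩
    have hprod : monomial m (1 : k) = (∏ i ∈ s, X i ^ m i) * ∏ i ∈ sᶜ, X i ^ m i := by
      rw [Finset.prod_mul_prod_compl, monomial_eq, C_1, one_mul,
        Finsupp.prod_fintype _ _ (fun i => pow_zero _)]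
    change monomial m (1 : k) ∈ _
    rw [hprod]
    refine Ideal.mul_mem_right _ _ (Ideal.pow_le_pow_right hm ?_)
    rw [← Finset.prod_pow_eq_pow_sum]
    refine Ideal.prod_mem_prod fun i hi => Ideal.pow_mem_pow (Ideal.subset_span ?_) _
    exact ⟨i, hi, rfl⟩

/-- Upward closure puts every monomial of an element of the ideal in `E`. -/
theorem componentIdeal_span_monomial {E : Set (σ →₀ ℕ)} (hE : IsUpperSet E) (d : ℕ) :
    componentIdeal (Ideal.span ((fun m => monomial m (1 : k)) '' E)) d =
      Ideal.span ((fun m => monomial m (1 : k)) '' {m | m ∈ E ∧ m.degree = d}) := by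
  apply le_antisymm
  · refine Ideal.span_le.2 ?_
    rintro f ⟨hf, hfd⟩
    refine mem_ideal_span_monomial_image.2 fun m hm => ?_
    obtain ⟨m', hm', hle⟩ := mem_ideal_span_monomial_image.1 hf m hm
    refine ⟨m, ⟨hE hle hm', ?_⟩, le_rfl⟩
    by_contra hne
    exact mem_support_iff.1 hm (hfd.coeff_eq_zero hne)
  · refine Ideal.span_mono ?_
    rintro _ ⟨m, ⟨hm, hmd⟩, rfl⟩
    refine ⟨Ideal.subset_span ⟨m, hm, rfl⟩, isHomogeneous_monomial 1 hmd⟩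

theorem exists_gt_lt_of_degree_eq {N : ℕ} {x y : Fin N →₀ ℕ} {j : Fin N}
    (hd : x.degree = y.degree) (hlt : ∀ i < j, x i = y i) (hj : x j < y j) :
    ∃ l, j < l ∧ y l < x l := by
  by_contra! h
  rw [Finsupp.degree_eq_sum, Finsupp.degree_eq_sum] at hd
  refine hd.not_lt (Finset.sum_lt_sum (fun i _ => ?_) ⟨j, Finset.mem_univ j, hj⟩)
  obtain hi | rfl | hi := lt_trichotomy i j
  · exact (hlt i hi).le
  · exact hj.le
  · exact h i hi

/-- The indices `i < e`. -/
abbrev indicesBelow (N e : ℕ) : Finset (Fin N) := Finset.univ.filter fun i => (i : ℕ) < e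

/-- Exchange property, with respect to the lexicographic order, of the monomials in
`(x_i : i < e) ^ (r + 1) + (x ^ (a + b))`. -/
theorem exists_exchange {N e r : ℕ} {a b x y : Fin N →₀ ℕ} {j : Fin N}
    (ha : ∀ i ∈ a.support, (i : ℕ) < e) (har : a.degree = r)
    (hb : ∀ i ∈ b.support, e ≤ (i : ℕ)) (hb_pos : 0 < b.degree)
    (hx : r + 1 ≤ ∑ i ∈ indicesBelow N e, x i ∨ a + b ≤ x)
    (hy : r + 1 ≤ ∑ i ∈ indicesBelow N e, y i ∨ a + b ≤ y)
    (hd : x.degree = y.degree) (hlt : ∀ i < j, x i = y i) (hj : x j < y j) :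
    ∃ l z, j < l ∧ z + Finsupp.single l 1 = x + Finsupp.single j 1 ∧
      (r + 1 ≤ ∑ i ∈ indicesBelow N e, z i ∨ a + b ≤ z) := by
  obtain ⟨l₀, hl₀, hyx⟩ := exists_gt_lt_of_degree_eq hd hlt hj
  -- Here `z` is the exponent of `x · x_j / x_l`, with its degree in the first `e` variables
  -- tracked.
  have hz : ∀ l, 0 < x l → ∃ z, z + Finsupp.single l 1 = x + Finsupp.single j 1 ∧
      (∑ i ∈ indicesBelow N e, z i) + (if (l : ℕ) < e then 1 else 0) =
        (∑ i ∈ indicesBelow N e, x i) + (if (j : ℕ) < e then 1 else 0) := by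
    intro l hl
    have h : x + Finsupp.single j 1 - Finsupp.single l 1 + Finsupp.single l 1 =
        x + Finsupp.single j 1 := by
      refine tsub_add_cancel_of_le (le_add_right ?_)
      rw [Finsupp.single_le_iff]
      exact hl
    refine ⟨_, h, ?_⟩
    have := congrArg (fun m : Fin N →₀ ℕ => ∑ i ∈ indicesBelow N e, m i) h
    simpa [Finset.sum_add_distrib, Finsupp.single_apply] using this
  obtain hx' | hx' := le_or_gt (r + 1) (∑ i ∈ indicesBelow N e, x i)
  · obtain ⟨z, hz, hsum⟩ := hz l₀ (by omega)
    refine ⟨l₀, z, hl₀, hz, Or.inl ?_⟩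
    -- If `l₀ < e` then `j < e` too, so the degree in the first `e` variables does not drop.
    have : (j : ℕ) < l₀ := hl₀
    split_ifs at hsum <;> omega
  · replace hx := hx.resolve_left (by omega)
    have hsa : ∑ i ∈ indicesBelow N e, a i = r := by
      rw [← har, Finsupp.degree_eq_sum]
      refine Finset.sum_subset (Finset.subset_univ _) fun i _ hi => ?_
      by_contra h
      exact hi (Finset.mem_filter.2 ⟨Finset.mem_univ i, ha i (Finsupp.mem_support_iff.2 h)⟩)
    have hax : ∑ i ∈ indicesBelow N e, a i ≤ ∑ i ∈ indicesBelow N e, x i :=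
      Finset.sum_le_sum fun i _ => (le_self_add.trans hx : a ≤ x) i
    -- Now `x` has degree exactly `r` in the first `e` variables. If `j < e`, trading a variable of
    -- `v` for `x_j` raises it to `r + 1`. If `j ≥ e`, then `y` has the same degree `r` there, so `a
    -- + b ≤ y`, and `(a + b) l₀ ≤ y l₀ < x l₀` allows removing `x_{l₀}`.
    obtain hje | hje := lt_or_ge (j : ℕ) e
    · obtain ⟨l, hl⟩ : ∃ l, b l ≠ 0 := by
        by_contra! h
        rw [show b = 0 from Finsupp.ext h] at hb_pos
        simp at hb_pos
      have hle := hb l (Finsupp.mem_support_iff.2 hl)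
      have hbx : b l ≤ x l := (le_add_self.trans hx : b ≤ x) l
      obtain ⟨z, hz, hsum⟩ := hz l (by omega)
      refine ⟨l, z, Fin.lt_def.2 (by omega), hz, Or.inl ?_⟩
      rw [if_neg (by omega), if_pos hje] at hsum
      omega
    · have hxy : ∑ i ∈ indicesBelow N e, x i = ∑ i ∈ indicesBelow N e, y i := by
        refine Finset.sum_congr rfl fun i hi => hlt i (Fin.lt_def.2 ?_)
        have := (Finset.mem_filter.1 hi).2
        omega
      replace hy := hy.resolve_left (by omega)
      obtain ⟨z, hz, -⟩ := hz l₀ (by omega)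
      refine ⟨l₀, z, hl₀, hz, Or.inr fun i => ?_⟩
      have h1 := DFunLike.congr_fun hz i
      have h2 := hx i
      have h3 := hy i
      rw [Finsupp.add_apply, Finsupp.add_apply, Finsupp.single_apply, Finsupp.single_apply] at h1
      rcases eq_or_ne l₀ i with rfl | hi
      · rw [if_pos rfl, if_neg hl₀.ne] at h1
        omega
      · rw [if_neg hi] at h1
        omega

end MonomialIdeals

/-! ### Assembly: lexicographic linear quotients in each degree. -/

theorem corollary42 {k : Type*} [Field k] (n e r : ℕ)
    (a b : Fin (n + e + 1) →₀ ℕ)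
    (ha : ∀ i ∈ a.support, (i : ℕ) < e) (har : a.degree = r)
    (hb : ∀ i ∈ b.support, e ≤ (i : ℕ)) (hb_pos : 0 < b.degree)
    (u v : MvPolynomial (Fin (n + e + 1)) k)
    (hu : u = monomial a 1) (hv : v = monomial b 1) :
    IsComponentwiseLinear
      (Ideal.span ((X : Fin (n + e + 1) → MvPolynomial (Fin (n + e + 1)) k) ''
          {i | (i : ℕ) < e}) ^ (r + 1) + Ideal.span {u * v}) := by
  set E : Set (Fin (n + e + 1) →₀ ℕ) :=
    {m | r + 1 ≤ ∑ i ∈ indicesBelow (n + e + 1) e, m i ∨ a + b ≤ m} with hE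
  have hup : IsUpperSet E := by
    rintro x y hxy (hx | hx)
    · exact Or.inl (hx.trans (Finset.sum_le_sum fun i _ => hxy i))
    · exact Or.inr (hx.trans hxy)
  have hI : Ideal.span ((X : Fin (n + e + 1) → MvPolynomial (Fin (n + e + 1)) k) ''
          {i | (i : ℕ) < e}) ^ (r + 1) + Ideal.span {u * v} =
      Ideal.span ((fun m => monomial m (1 : k)) '' E) := by
    have hs : {i : Fin (n + e + 1) | (i : ℕ) < e} =
        (indicesBelow (n + e + 1) e : Set _) := by
      ext
      simp
    rw [hs, span_X_image_pow, hu, hv, monomial_mul, one_mul, Submodule.add_eq_sup]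
    apply le_antisymm
    · refine sup_le (Ideal.span_mono (Set.image_mono fun m hm => Or.inl hm)) ?_
      rw [Ideal.span_singleton_le_iff_mem]
      exact Ideal.subset_span ⟨a + b, Or.inr le_rfl, rfl⟩
    · rw [Ideal.span_le]
      rintro _ ⟨m, hm | hm, rfl⟩
      · exact Ideal.mem_sup_left (Ideal.subset_span ⟨m, hm, rfl⟩)
      · refine Ideal.mem_sup_right (Ideal.mem_span_singleton.2 ?_)
        exact monomial_dvd_monomial.2 ⟨Or.inr hm, dvd_rfl⟩
  rw [hI]
  refine ⟨isHomogeneous_span_monomial E, fun d => ?_⟩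
  rw [componentIdeal_span_monomial hup]
  have hfin : {x : Lex (Fin (n + e + 1) →₀ ℕ) | ofLex x ∈ E ∧ (ofLex x).degree = d}.Finite := by
    refine Set.Finite.preimage (f := ofLex) (ofLex.injective.injOn)
      (s := {m : Fin (n + e + 1) →₀ ℕ | m ∈ E ∧ m.degree = d})
      ((Finset.finite_toSet (Finset.finsuppAntidiag Finset.univ d)).subset ?_)
    rintro m ⟨-, hm⟩
    rw [Finsupp.degree_eq_sum] at hm
    simpa using hm
  have key := linearlyResolved_span_monomial (k := k) (d := d)
    (fun x : Lex (Fin (n + e + 1) →₀ ℕ) => ofLex x) hfin.toFinset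
    (fun x hx => ((Set.Finite.mem_toFinset hfin).1 hx).2) ?_
  · have himg : (fun x : Lex (Fin (n + e + 1) →₀ ℕ) => ofLex x) '' (hfin.toFinset : Set _) =
        {m | m ∈ E ∧ m.degree = d} := by
      rw [hfin.coe_toFinset]
      ext m
      exact ⟨by rintro ⟨x, hx, rfl⟩; exact hx, fun hm => ⟨toLex m, hm, rfl⟩⟩
    rw [himg] at key
    exact key.hasLinearResolution
  · intro x hx y hy hxy
    obtain ⟨hxE, hxd⟩ := (Set.Finite.mem_toFinset hfin).1 hx
    obtain ⟨hyE, hyd⟩ := (Set.Finite.mem_toFinset hfin).1 hy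
    obtain ⟨j, hlt, hj⟩ := Finsupp.Lex.lt_iff.1 hxy
    obtain ⟨l, z, hjl, hz, hzE⟩ := exists_exchange ha har hb hb_pos hxE hyE (hxd.trans hyd.symm)
      hlt hj
    have hzi : ∀ i, z i + Finsupp.single l 1 i = ofLex x i + Finsupp.single j 1 i :=
      DFunLike.congr_fun hz
    -- The colon variable is `x_j`; as `l > j`, the exchanged monomial first differs from `x` at
    -- `j`, where it is larger.
    refine ⟨j, hj, toLex z, (Set.Finite.mem_toFinset hfin).2 ⟨hzE, ?_⟩,
      Finsupp.Lex.lt_iff.2 ⟨j, fun i hi => ?_, ?_⟩, ?_⟩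
    · have := congrArg Finsupp.degree hz
      rw [map_add, map_add, Finsupp.degree_single, Finsupp.degree_single, hxd] at this
      exact Nat.add_right_cancel this
    · have := hzi i
      rw [Finsupp.single_apply, Finsupp.single_apply, if_neg (hi.trans hjl).ne',
        if_neg hi.ne'] at this
      exact this.symm
    · have := hzi j
      rw [Finsupp.single_apply, Finsupp.single_apply, if_neg hjl.ne', if_pos rfl] at this
      change ofLex x j < z j
      omega
    · change z ≤ _
      rw [← hz]
      exact le_self_add
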